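/- Let $A\in\mathbb R^{m\times n}$, let $N=n_1+\dots+n_K\ge 1$, and let $B=[B[1];\dots;B[K]]\in\mathbb R^{N\times n}$ with $B[k]\in\mathbb R^{n_k\times n}$. For a block vector $w=[w[1];\dots;w[K]]\in\mathbb R^N$ with $w[k]\in\mathbb R^{n_k}$, put $L_1(w)=\sum_{k=1}^K\|w[k]\|_\infty$, and for a positive integer $S$ let $w^S$ be obtained from $w$ by zeroing out all but the $S$ blocks largest in the norm $\|\cdot\|_\infty$ (ties resolved arbitrarily; $w^S=w$ if $S\ge K$). For a matrix $M$ let $\|M\|_{\infty,\infty}=\max_{\|v\|_\infty\le1}\|Mv\|_\infty$. For $\delta\in(0,1)$ let $\mathrm{ErfInv}(\delta)$ be the number $t$ with $\mathrm{Prob}\{g\ge t\}=\delta$, $g\sim\mathcal N(0,1)$. Let $\mathcal U\subset\mathbb R^m$ be a compact convex set symmetric with respect to the origin, let $D\in\mathbb R^{m\times m}$, let $\xi=D\eta$ with $\eta\sim\mathcal N(0,I_m)$, and let $\varepsilon\in(0,1/2)$. Suppose that for every $r>0$ the set $\{u+De:\ u\in\mathcal U,\ \|e\|_2\le r\}$ contains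 a neighborhood of the origin. Let $S$ be a positive integer and $\alpha>0$, and assume that there is a recovery routine $\widehat x:\mathbb R^m\to\mathbb R^n$ such that for all $x\in\mathbb R^n$ and $u\in\mathcal U$ $$\mathrm{Prob}_\xi\Bigl(\bigl\|B[x-\widehat x(Ax+u+\xi)]\bigr\|_\infty\le\alpha+S^{-1}L_1\bigl(Bx-[Bx]^S\bigr)\Bigr)\ge1-\varepsilon .$$ Then there exist $H=[h^1,\dots,h^N]\in\mathbb R^{m\times N}$ and $V=[V^{k\ell}]_{k,\ell=1}^K\in\mathbb R^{N\times N}$ with blocks $V^{k\ell}\in\mathbb R^{n_k\times n_\ell}$ such that (a) $B=VB+H^TA$; (b) $\|V^{k\ell}\|_{\infty,\infty}\le 2S^{-1}$ for all $k,\ell\le K$; (c) with $$\rho:=\max_{1\le i\le N}\Bigl[\max_{u\in\mathcal U}u^Th^i+\mathrm{ErfInv}\Bigl(\frac{\varepsilon}{2N}\Bigr)\|D^Th^i\|_2\Bigr]$$ one has $\rho\le2\alpha$ when $D=0$ and $\rho\le2\alpha\,\dfrac{\mathrm{ErfInv}(\varepsilon/(2N))}{\mathrm{ErfInv}(\varepsilon)}$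 when $D\ne0$, and moreover $$\mathrm{Prob}_\xi\Bigl(\max_{u\in\mathcal U}u^Th^i+|\xi^Th^i|\le\rho,\ 1\le i\le N\Bigr)\ge1-\varepsilon .$$ -/

import Mathlib

open MeasureTheory ProbabilityTheory Matrix Topology

noncomputable section

namespace BlockRecovery

/-- Index set of the representation space `ℝ^{n₁} × ⋯ × ℝ^{n_K}`: the pair `⟨k, j⟩` is the `j`-th
coordinate of the `k`-th block. It has `N = n₁ + ⋯ + n_K` elements. -/
abbrev BlockIdx {K : ℕ} (nb : Fin K → ℕ) : Type := (k : Fin K) × Fin (nb k)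

variable {K : ℕ} {nb : Fin K → ℕ}

/-- The `k`-th block `w[k]` of a block vector. The norm of `Fin (nb k) → ℝ` is the max-norm, so
`‖block w k‖` is the magnitude of the block when all block norms are `ℓ_∞`-norms. -/
def block (w : BlockIdx nb → ℝ) (k : Fin K) : Fin (nb k) → ℝ := fun j => w ⟨k, j⟩

/-- `L₁(w) = ∑_k ‖w[k]‖_∞`. -/
def L1 (w : BlockIdx nb → ℝ) : ℝ := ∑ k, ‖block w k‖

/-- There is a set of `min s K` blocks of `w` which are the largest in magnitude. -/
theorem exists_topBlocks (s : ℕ) (w : BlockIdx nb → ℝ) :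
    ∃ I : Finset (Fin K), I.card = min s K ∧
      ∀ k ∈ I, ∀ l ∉ I, ‖block w l‖ ≤ ‖block w k‖ := by
  induction s with
  | zero => exact ⟨∅, by simp, by simp⟩
  | succ s ih =>
    obtain ⟨I, hI, hmax⟩ := ih
    rcases Nat.lt_or_ge s K with h | h
    · have hne : (Iᶜ).Nonempty := by
        rw [← Finset.card_pos, Finset.card_compl, Fintype.card_fin, hI]
        omega
      obtain ⟨a, ha, hamax⟩ := Finset.exists_max_image Iᶜ (fun k => ‖block w k‖) hne
      have haI : a ∉ I := by simpa using ha
      refine ⟨insert a I, ?_, ?_⟩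
      · rw [Finset.card_insert_of_notMem haI, hI]
        omega
      · intro k hk l hl
        rw [Finset.mem_insert, not_or] at hl
        rcases Finset.mem_insert.1 hk with rfl | hk
        · exact hamax l (by simpa using hl.2)
        · exact hmax k hk l hl.2
    · exact ⟨I, by omega, hmax⟩

/-- Indices of the `s` largest in magnitude blocks of `w` (ties resolved arbitrarily; all blocks
if `s ≥ K`). -/
def topBlocks (s : ℕ) (w : BlockIdx nb → ℝ) : Finset (Fin K) :=
  Classical.choose (exists_topBlocks s w)

/-- `w^s`: the vector `w` with all but its `s` largest in magnitude blocks zeroed out. -/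
def blockTrunc (s : ℕ) (w : BlockIdx nb → ℝ) : BlockIdx nb → ℝ :=
  fun i => if i.1 ∈ topBlocks s w then w i else 0

/-- The `(k, l)` block `V^{kl}`, an `n_k × n_l` matrix, of an `N × N` matrix `V`. -/
def matBlock (V : Matrix (BlockIdx nb) (BlockIdx nb) ℝ) (k l : Fin K) :
    Matrix (Fin (nb k)) (Fin (nb l)) ℝ :=
  V.submatrix (fun i => ⟨k, i⟩) (fun j => ⟨l, j⟩)

/-- `‖M‖_{∞,∞}`: the norm of the operator `v ↦ M v` with respect to the max-norms on the argument
and the image spaces. -/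
def normInfInf {p q : ℕ} (M : Matrix (Fin p) (Fin q) ℝ) : ℝ :=
  ‖LinearMap.toContinuousLinearMap (Matrix.toLin' M)‖

/-- The Euclidean norm on `ℝ^m`. -/
def norm2 {m : ℕ} (v : Fin m → ℝ) : ℝ := ‖WithLp.toLp 2 v‖

/-- `μ_U(h) = max_{u ∈ U} uᵀ h` (the maximum is attained when `U` is compact and nonempty). -/
def suppFun {m : ℕ} (U : Set (Fin m → ℝ)) (h : Fin m → ℝ) : ℝ :=
  sSup ((fun u => u ⬝ᵥ h) '' U)

/-- The tail `Erf(t) = Prob{g ≥ t}`, `g ∼ N(0, 1)`, of the standard normal distribution. -/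
def gaussianTail (t : ℝ) : ℝ := (gaussianReal 0 1).real (Set.Ici t)

/-- The inverse of the (continuous and strictly decreasing) function `gaussianTail`:
for `0 < δ < 1`, it is the `t` with `Prob{g ≥ t} = δ`. -/
def erfInv (δ : ℝ) : ℝ := sInf {t : ℝ | gaussianTail t ≤ δ}

/-- The distribution of `ξ = D η`, where `η ∼ N(0, I_m)`, that is, where the entries of `η` are
independent standard normal variables. -/
def noiseLaw {m : ℕ} (D : Matrix (Fin m) (Fin m) ℝ) : Measure (Fin m → ℝ) :=
  (Measure.pi fun _ : Fin m => gaussianReal 0 1).map (fun η => D *ᵥ η)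

/-- `ρ = max_{1 ≤ i ≤ N} [ max_{u ∈ U} uᵀ hⁱ + ErfInv(ε / (2N)) ‖Dᵀ hⁱ‖₂ ]`, where `hⁱ` are the
columns of `H`. -/
def rho {m : ℕ} (U : Set (Fin m → ℝ)) (D : Matrix (Fin m) (Fin m) ℝ) (ε : ℝ)
    (H : Matrix (Fin m) (BlockIdx nb) ℝ) : ℝ :=
  ⨆ i : BlockIdx nb,
    (suppFun U (H.col i) + erfInv (ε / (2 * (∑ k, nb k : ℕ))) * norm2 (Dᵀ *ᵥ H.col i))

end BlockRecovery

end

open BlockRecovery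

/-! Since `‖·‖_{∞,∞}` is the largest `ℓ₁`-norm of a row, conditions (a) and (b) decouple over the
rows of `B`: each row `b` must equal `vᵀB + hᵀA` with all blocks of `v` of `ℓ₁`-norm at most `2/S`.
By separation (`exists_vecMul_add_vecMul_eq`) such `v` and `h` exist, with `h` in the `2α`-multiple
of the polar of the error set, once `bᵀx ≤ (2/S) L₁(Bx) + 2α` whenever `Ax = u + De`, `u ∈ U`, `‖e‖₂
≤ ErfInv(ε)`.

The recovery routine supplies this inequality (`norm_mulVec_le_of_recovery`). Let `Ax = u + De` with
`‖e‖₂ < ErfInv(ε)`. The signal `x` with nuisance `-u` and the signal `-x` with nuisance `u` are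
observed as `D(η + e)` and `D(η - e)`. If `‖Bx‖ > α + S⁻¹ L₁(Bx)`, no estimate serves both, so the
success events separate `N(e, I)` from `N(-e, I)` with both errors at most `ε`. But the errors of
any test sum to at least `2 Prob{g ≥ ‖e‖₂} > 2ε` (`pi_gaussianReal_real_add_le_of_disjoint`).

Replacing `ErfInv(ε)` by `ErfInv(ε/(2N))` costs the ratio in (c) and pays for a union bound over the
`N` columns. -/

namespace BlockRecovery

/-! ### The normal tail and its inverse. -/

section GaussianTail

theorem gaussianTail_antitone : Antitone gaussianTail := fun _ _ h =>
  measureReal_mono (Set.Ici_subset_Ici.2 h)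

theorem gaussianReal_real_Iic_neg (t : ℝ) :
    (gaussianReal 0 1).real (Set.Iic (-t)) = gaussianTail t := by
  have h := gaussianReal_map_neg (μ := 0) (v := 1)
  rw [neg_zero] at h
  rw [gaussianTail, ← h, map_measureReal_apply measurable_neg measurableSet_Iic, h]
  congr 1
  ext x
  simp

theorem gaussianReal_real_Iio (t : ℝ) :
    (gaussianReal 0 1).real (Set.Iio t) = 1 - gaussianTail t := by
  rw [gaussianTail, ← probReal_compl_eq_one_sub measurableSet_Ici, Set.compl_Ici]

theorem gaussianReal_real_Ici_neg (t : ℝ) :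
    (gaussianReal 0 1).real (Set.Ici (-t)) = 1 - gaussianTail t := by
  have := nullSingletonClass_gaussianReal (μ := 0) (v := 1) one_ne_zero
  rw [← gaussianReal_real_Iic_neg t, ← probReal_compl_eq_one_sub measurableSet_Iic, Set.compl_Iic]
  exact measureReal_congr Ioi_ae_eq_Ici.symm

theorem gaussianTail_zero : gaussianTail 0 = 1 / 2 := by
  have h := gaussianReal_real_Ici_neg 0
  rw [neg_zero] at h
  change gaussianTail 0 = 1 - gaussianTail 0 at h
  linarith

theorem tendsto_gaussianTail_atTop : Filter.Tendsto gaussianTail Filter.atTop (𝓝 0) := by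
  have h := (tendsto_cdf_atTop (gaussianReal 0 1)).const_sub 1
  rw [sub_self] at h
  refine h.congr fun t => ?_
  have := nullSingletonClass_gaussianReal (μ := 0) (v := 1) one_ne_zero
  rw [cdf_eq_real, ← measureReal_congr (Iio_ae_eq_Iic (μ := gaussianReal 0 1) (a := t)),
    gaussianReal_real_Iio]
  ring

theorem tendsto_gaussianTail_atBot : Filter.Tendsto gaussianTail Filter.atBot (𝓝 1) := by
  have h := (tendsto_gaussianTail_atTop.comp Filter.tendsto_neg_atBot_atTop).const_sub 1
  rw [sub_zero] at h
  refine h.congr fun t => ?_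
  have := gaussianReal_real_Ici_neg (-t)
  rw [neg_neg] at this
  exact this.symm

theorem bddBelow_setOf_gaussianTail_le {δ : ℝ} (hδ : δ < 1) :
    BddBelow {t | gaussianTail t ≤ δ} := by
  obtain ⟨a, ha⟩ := (tendsto_gaussianTail_atBot.eventually (lt_mem_nhds hδ)).exists
  refine ⟨a, fun t ht => ?_⟩
  by_contra! h
  exact absurd ((gaussianTail_antitone h.le).trans ht) (not_le.2 ha)

theorem nonempty_setOf_gaussianTail_le {δ : ℝ} (hδ : 0 < δ) :
    {t | gaussianTail t ≤ δ}.Nonempty := by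
  obtain ⟨a, ha⟩ := (tendsto_gaussianTail_atTop.eventually (gt_mem_nhds hδ)).exists
  exact ⟨a, ha.le⟩

theorem lt_gaussianTail_of_lt_erfInv {δ t : ℝ} (hδ : δ < 1) (ht : t < erfInv δ) :
    δ < gaussianTail t := by
  by_contra! h
  exact absurd (csInf_le (bddBelow_setOf_gaussianTail_le hδ) h) (not_le.2 ht)

theorem erfInv_le_erfInv {δ δ' : ℝ} (h0 : 0 < δ) (h : δ ≤ δ') (h1 : δ' < 1) :
    erfInv δ' ≤ erfInv δ :=
  csInf_le_csInf (bddBelow_setOf_gaussianTail_le h1) (nonempty_setOf_gaussianTail_le h0)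
    fun _ ht => le_trans ht h

/-- For the open ray this needs only the definition of `erfInv` as an infimum and continuity of
measure along increasing unions, not attainment of the infimum. -/
theorem gaussianReal_real_Ioi_erfInv_le {δ : ℝ} (h0 : 0 < δ) :
    (gaussianReal 0 1).real (Set.Ioi (erfInv δ)) ≤ δ := by
  have hlim : Filter.Tendsto (fun n : ℕ => gaussianTail (erfInv δ + 1 / ((n : ℝ) + 1)))
      Filter.atTop (𝓝 ((gaussianReal 0 1).real (Set.Ioi (erfInv δ)))) := by
    have hU : Set.Ioi (erfInv δ) = ⋃ n : ℕ, Set.Ici (erfInv δ + 1 / ((n : ℝ) + 1)) := by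
      ext x
      simp only [Set.mem_Ioi, Set.mem_iUnion, Set.mem_Ici]
      constructor
      · intro hx
        obtain ⟨n, hn⟩ := exists_nat_one_div_lt (sub_pos.2 hx)
        exact ⟨n, by linarith⟩
      · rintro ⟨n, hn⟩
        have : (0 : ℝ) < 1 / ((n : ℝ) + 1) := by positivity
        linarith
    rw [hU]
    refine (ENNReal.tendsto_toReal (measure_ne_top _ _)).comp
      (tendsto_measure_iUnion_atTop fun i j hij => Set.Ici_subset_Ici.2 ?_)
    gcongr
  refine le_of_tendsto' hlim fun n => ?_
  obtain ⟨s, hs, hlt⟩ := exists_lt_of_csInf_lt (nonempty_setOf_gaussianTail_le h0)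
    (show erfInv δ < erfInv δ + 1 / ((n : ℝ) + 1) by
      have : (0 : ℝ) < 1 / ((n : ℝ) + 1) := by positivity
      linarith)
  exact (gaussianTail_antitone hlt.le).trans hs

theorem erfInv_pos {δ : ℝ} (h0 : 0 < δ) (h : δ < 1 / 2) : 0 < erfInv δ := by
  have hle : 0 ≤ erfInv δ := by
    by_contra! hneg
    obtain ⟨s, hs, hlt⟩ := exists_lt_of_csInf_lt (nonempty_setOf_gaussianTail_le h0) hneg
    have := gaussianTail_antitone hlt.le
    rw [gaussianTail_zero] at this
    have hs' : gaussianTail s ≤ δ := hs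
    linarith
  refine lt_of_le_of_ne hle fun heq => ?_
  have := nullSingletonClass_gaussianReal (μ := 0) (v := 1) one_ne_zero
  have h1 := gaussianReal_real_Ioi_erfInv_le h0
  rw [← heq, measureReal_congr Ioi_ae_eq_Ici] at h1
  change gaussianTail 0 ≤ δ at h1
  rw [gaussianTail_zero] at h1
  linarith

end GaussianTail

/-! ### Euclidean norm. -/

section Norm2

variable {m : ℕ}

theorem norm2_nonneg (v : Fin m → ℝ) : 0 ≤ norm2 v := norm_nonneg _

theorem dotProduct_self_eq_norm2_sq (v : Fin m → ℝ) : v ⬝ᵥ v = norm2 v ^ 2 := by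
  rw [norm2, EuclideanSpace.real_norm_sq_eq, dotProduct]
  exact Finset.sum_congr rfl fun i _ => (pow_two _).symm

theorem norm2_smul (c : ℝ) (v : Fin m → ℝ) : norm2 (c • v) = |c| * norm2 v := by
  rw [norm2, WithLp.toLp_smul, norm_smul, Real.norm_eq_abs, norm2]

end Norm2

/-! ### Testing between two shifts of the standard Gaussian. -/

section StdGaussian

variable {m : ℕ}

/-- A linear form of a Gaussian vector is Gaussian, so its mean and variance determine its law. -/
theorem map_dotProduct_pi_gaussianReal (e : Fin m → ℝ) :
    (Measure.pi fun _ : Fin m => gaussianReal 0 1).map (fun η => η ⬝ᵥ e) =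
      (gaussianReal 0 1).map (fun t => norm2 e * t) := by
  let L : StrongDual ℝ (EuclideanSpace ℝ (Fin m)) := innerSL ℝ (WithLp.toLp 2 e)
  have hL : (fun η : Fin m → ℝ => η ⬝ᵥ e) = L ∘ WithLp.toLp 2 := by
    ext η
    simp [L, PiLp.inner_apply, dotProduct, mul_comm]
  rw [hL, ← Measure.map_map (by fun_prop) (by fun_prop), map_pi_eq_stdGaussian,
    IsGaussian.map_eq_gaussianReal, integral_strongDual_stdGaussian, variance_dual_stdGaussian,
    gaussianReal_map_const_mul, mul_zero, mul_one]
  congr 1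
  have : ‖L‖ = norm2 e := by simp [L, norm2]
  rw [this]
  ext
  simp [sq_nonneg]

theorem pi_gaussianReal_eq_withDensity :
    (Measure.pi fun _ : Fin m => gaussianReal 0 1) =
      (volume : Measure (Fin m → ℝ)).withDensity
        (fun x => ENNReal.ofReal (∏ i, gaussianPDFReal 0 1 (x i))) := by
  refine Measure.pi_eq fun s hs => ?_
  rw [withDensity_apply _ (MeasurableSet.univ_pi hs), volume_pi, Measure.restrict_pi_pi,
    ← ofReal_integral_eq_lintegral_ofReal, integral_fintype_prod_eq_prod
      (μ := fun i => volume.restrict (s i)) (f := fun _ => gaussianPDFReal 0 1), ENNReal.ofReal_prod_of_nonneg]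
  · exact Finset.prod_congr rfl fun i _ => by
      rw [gaussianReal_apply_eq_integral _ one_ne_zero]
  · exact fun i _ => integral_nonneg fun x => gaussianPDFReal_nonneg _ _ _
  · exact Integrable.fintype_prod fun i => (integrable_gaussianPDFReal _ _).restrict
  · exact Filter.Eventually.of_forall fun x =>
      Finset.prod_nonneg fun i _ => gaussianPDFReal_nonneg _ _ _

theorem pi_gaussianReal_preimage_add (e : Fin m → ℝ) {F : Set (Fin m → ℝ)}
    (hF : MeasurableSet F) :
    (Measure.pi fun _ : Fin m => gaussianReal 0 1) ((fun x => x + e) ⁻¹' F) =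
      ∫⁻ x in F, ENNReal.ofReal (∏ i, gaussianPDFReal 0 1 ((x - e) i)) := by
  have hm : MeasurableSet ((fun x => x + e) ⁻¹' F) := hF.preimage (by fun_prop)
  rw [pi_gaussianReal_eq_withDensity, withDensity_apply _ hm, ← lintegral_indicator hm,
    ← lintegral_indicator hF, ← lintegral_sub_right_eq_self _ e]
  refine lintegral_congr fun x => ?_
  have hiff : x - e ∈ (fun x => x + e) ⁻¹' F ↔ x ∈ F := by rw [Set.mem_preimage, sub_add_cancel]
  by_cases hx : x ∈ F
  · rw [Set.indicator_of_mem hx, Set.indicator_of_mem (hiff.2 hx)]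
  · rw [Set.indicator_of_notMem hx, Set.indicator_of_notMem (mt hiff.1 hx)]

/-- The likelihood ratio of the shifts by `e` and `-e` is `exp (2 xᵀe)`, so the optimal test is a
half-space. -/
theorem prod_gaussianPDFReal_sub_le_iff (x e : Fin m → ℝ) :
    ∏ i, gaussianPDFReal 0 1 ((x + e) i) ≤ ∏ i, gaussianPDFReal 0 1 ((x - e) i) ↔
      0 ≤ x ⬝ᵥ e := by
  simp only [gaussianPDFReal, Finset.prod_mul_distrib, ← Real.exp_sum]
  rw [mul_le_mul_iff_right₀ (Finset.prod_pos fun i _ => by positivity), Real.exp_le_exp,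
    ← sub_nonneg, ← Finset.sum_sub_distrib]
  have : ∑ i, (-((x - e) i - 0) ^ 2 / (2 * ((1 : NNReal) : ℝ)) -
      -((x + e) i - 0) ^ 2 / (2 * ((1 : NNReal) : ℝ))) = 2 * (x ⬝ᵥ e) := by
    rw [dotProduct, Finset.mul_sum]
    refine Finset.sum_congr rfl fun i _ => ?_
    simp
    ring
  rw [this]
  constructor <;> intro h <;> linarith

theorem pi_gaussianReal_real_setOf_neg_le (e : Fin m → ℝ) (he : 0 < norm2 e) :
    (Measure.pi fun _ : Fin m => gaussianReal 0 1).real {η | -(norm2 e ^ 2) ≤ η ⬝ᵥ e} =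
      1 - gaussianTail (norm2 e) := by
  have hd : Measurable fun η : Fin m → ℝ => η ⬝ᵥ e := by unfold dotProduct; fun_prop
  have h : {η : Fin m → ℝ | -(norm2 e ^ 2) ≤ η ⬝ᵥ e} =
      (fun η => η ⬝ᵥ e) ⁻¹' Set.Ici (-(norm2 e ^ 2)) := rfl
  rw [h, ← map_measureReal_apply hd measurableSet_Ici, map_dotProduct_pi_gaussianReal,
    map_measureReal_apply (by fun_prop) measurableSet_Ici, ← gaussianReal_real_Ici_neg]
  congr 1
  ext t
  simp only [Set.mem_preimage, Set.mem_Ici]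
  constructor <;> intro h <;> nlinarith

theorem pi_gaussianReal_real_setOf_lt (e : Fin m → ℝ) (he : 0 < norm2 e) :
    (Measure.pi fun _ : Fin m => gaussianReal 0 1).real {η | η ⬝ᵥ e < norm2 e ^ 2} =
      1 - gaussianTail (norm2 e) := by
  have hd : Measurable fun η : Fin m → ℝ => η ⬝ᵥ e := by unfold dotProduct; fun_prop
  have h : {η : Fin m → ℝ | η ⬝ᵥ e < norm2 e ^ 2} =
      (fun η => η ⬝ᵥ e) ⁻¹' Set.Iio (norm2 e ^ 2) := rfl
  rw [h, ← map_measureReal_apply hd measurableSet_Iio, map_dotProduct_pi_gaussianReal,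
    map_measureReal_apply (by fun_prop) measurableSet_Iio, ← gaussianReal_real_Iio]
  congr 1
  ext t
  simp only [Set.mem_preimage, Set.mem_Iio]
  constructor <;> intro h <;> nlinarith

/-- The Neyman–Pearson bound: no test tells the shift of the standard Gaussian distribution
by `e` from its shift by `-e` better than the half-space test does. -/
theorem pi_gaussianReal_real_add_le_of_disjoint (e : Fin m → ℝ) {F G : Set (Fin m → ℝ)}
    (hF : MeasurableSet F) (hG : MeasurableSet G) (hFG : Disjoint F G) :
    (Measure.pi fun _ : Fin m => gaussianReal 0 1).real ((fun x => x + e) ⁻¹' F) +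
      (Measure.pi fun _ : Fin m => gaussianReal 0 1).real ((fun x => x - e) ⁻¹' G) ≤
      2 * (1 - gaussianTail (norm2 e)) := by
  set γ := Measure.pi fun _ : Fin m => gaussianReal 0 1
  -- For `e = 0` the right-hand side is 1, a trivial bound for disjoint sets; the half-space
  -- probabilities below require `e ≠ 0`.
  rcases (norm2_nonneg e).eq_or_lt with h0 | hpos
  · have he : e = 0 := by
      rw [norm2, eq_comm, norm_eq_zero, WithLp.toLp_eq_zero] at h0
      exact h0
    subst he
    rw [← h0, gaussianTail_zero]
    simp only [add_zero, sub_zero, Set.preimage_id']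
    rw [← measureReal_union hFG hG]
    exact measureReal_le_one.trans (by norm_num)
  let p : (Fin m → ℝ) → ENNReal := fun x => ENNReal.ofReal (∏ i, gaussianPDFReal 0 1 ((x - e) i))
  let r : (Fin m → ℝ) → ENNReal := fun x => ENNReal.ofReal (∏ i, gaussianPDFReal 0 1 ((x + e) i))
  have hp : ∀ {F : Set (Fin m → ℝ)}, MeasurableSet F →
      γ ((fun x => x + e) ⁻¹' F) = ∫⁻ x in F, p x := pi_gaussianReal_preimage_add e
  have hr : ∀ {F : Set (Fin m → ℝ)}, MeasurableSet F →
      γ ((fun x => x - e) ⁻¹' F) = ∫⁻ x in F, r x := fun hF => by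
    simpa [r, sub_eq_add_neg] using pi_gaussianReal_preimage_add (-e) hF
  have hd : Measurable fun η : Fin m → ℝ => η ⬝ᵥ e := by unfold dotProduct; fun_prop
  let E : Set (Fin m → ℝ) := {x | 0 ≤ x ⬝ᵥ e}
  have hE : MeasurableSet E := measurableSet_le measurable_const hd
  have key : γ ((fun x => x + e) ⁻¹' F) + γ ((fun x => x - e) ⁻¹' G) ≤
      γ ((fun x => x + e) ⁻¹' E) + γ ((fun x => x - e) ⁻¹' Eᶜ) := by
    rw [hp hF, hr hG, hp hE, hr hE.compl]
    -- Disjoint sets collect at most the integral of `max p r`, and the half-space `E` with its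
    -- complement attains it.
    calc (∫⁻ x in F, p x) + ∫⁻ x in G, r x
        ≤ (∫⁻ x in F, max (p x) (r x)) + ∫⁻ x in G, max (p x) (r x) :=
          add_le_add (lintegral_mono fun x => le_max_left _ _)
            (lintegral_mono fun x => le_max_right _ _)
      _ = ∫⁻ x in F ∪ G, max (p x) (r x) := (lintegral_union hG hFG).symm
      _ ≤ ∫⁻ x, max (p x) (r x) := setLIntegral_le_lintegral _ _
      _ = (∫⁻ x in E, max (p x) (r x)) + ∫⁻ x in Eᶜ, max (p x) (r x) :=
          (lintegral_add_compl _ hE).symm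
      _ = (∫⁻ x in E, p x) + ∫⁻ x in Eᶜ, r x := by
          congr 1
          · refine setLIntegral_congr_fun hE fun x hx => max_eq_left ?_
            exact ENNReal.ofReal_le_ofReal ((prod_gaussianPDFReal_sub_le_iff x e).2 hx)
          · refine setLIntegral_congr_fun hE.compl fun x hx => max_eq_right ?_
            refine ENNReal.ofReal_le_ofReal (le_of_not_ge fun h => hx ?_)
            exact (prod_gaussianPDFReal_sub_le_iff x e).1 h
  have h1 : (fun x => x + e) ⁻¹' E = {η : Fin m → ℝ | -(norm2 e ^ 2) ≤ η ⬝ᵥ e} := by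
    ext x
    simp only [E, Set.mem_preimage, Set.mem_ofPred_eq, add_dotProduct, dotProduct_self_eq_norm2_sq]
    constructor <;> intro h <;> linarith
  have h2 : (fun x => x - e) ⁻¹' Eᶜ = {η : Fin m → ℝ | η ⬝ᵥ e < norm2 e ^ 2} := by
    ext x
    simp only [E, Set.mem_preimage, Set.mem_compl_iff, Set.mem_ofPred_eq, sub_dotProduct,
      dotProduct_self_eq_norm2_sq, not_le]
    constructor <;> intro h <;> linarith
  have h3 := pi_gaussianReal_real_setOf_neg_le e hpos
  have h4 := pi_gaussianReal_real_setOf_lt e hpos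
  rw [h1, h2] at key
  have := ENNReal.toReal_mono (by finiteness) key
  rw [ENNReal.toReal_add (by finiteness) (by finiteness),
    ENNReal.toReal_add (by finiteness) (by finiteness)] at this
  change γ.real _ + γ.real _ ≤ γ.real _ + γ.real _ at this
  linarith

end StdGaussian

/-! ### Polarity and a theorem of the alternative. -/

section Duality

/-- The bipolar theorem at level `c`: a functional strictly separating `z` from `W`, rescaled by `c
/ s`, would violate `hz`. -/
theorem mem_of_forall_dotProduct_le {m : ℕ} {W : Set (Fin m → ℝ)} (hWc : IsClosed W)
    (hWconv : Convex ℝ W) (hW0 : 0 ∈ W) {c : ℝ} (hc : 0 < c) {z : Fin m → ℝ}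
    (hz : ∀ h : Fin m → ℝ, (∀ w ∈ W, w ⬝ᵥ h ≤ c) → z ⬝ᵥ h ≤ c) : z ∈ W := by
  by_contra hzW
  obtain ⟨f, s, hf, hs⟩ := geometric_hahn_banach_closed_point hWconv hWc hzW
  obtain ⟨g, hg⟩ : ∃ g : Fin m → ℝ, ∀ y, f y = y ⬝ᵥ g := by
    refine ⟨fun i => f (Pi.single i 1), fun y => ?_⟩
    conv_lhs => rw [pi_eq_sum_univ' y, map_sum]
    simp [dotProduct]
  have hs0 : 0 < s := by simpa using hf 0 hW0
  have h := hz ((c / s) • g) fun w hw => by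
    rw [dotProduct_smul, ← hg, smul_eq_mul, div_mul_eq_mul_div, div_le_iff₀ hs0]
    exact mul_le_mul_of_nonneg_left (hf w hw).le hc.le
  rw [dotProduct_smul, ← hg, smul_eq_mul, div_mul_eq_mul_div, div_le_iff₀ hs0] at h
  exact absurd (le_of_mul_le_mul_left h hc) (not_le.2 hs)

/-- This is where the error set must contain a neighborhood of the origin: testing `h` on vectors `±
r` along the axes bounds its coordinates. -/
theorem isCompact_setOf_forall_dotProduct_le {m : ℕ} {W : Set (Fin m → ℝ)} (hW : W ∈ 𝓝 0)
    {c : ℝ} (hc : 0 < c) : IsCompact {h : Fin m → ℝ | ∀ w ∈ W, w ⬝ᵥ h ≤ c} := by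
  obtain ⟨r, hr, hrW⟩ := Metric.nhds_basis_closedBall.mem_iff.1 hW
  refine Metric.isCompact_of_isClosed_isBounded ?_ ?_
  · simp only [Set.ofPred_forall]
    refine isClosed_iInter fun w => isClosed_iInter fun _ => isClosed_le ?_ continuous_const
    unfold dotProduct
    fun_prop
  · refine (Metric.isBounded_closedBall (x := (0 : Fin m → ℝ)) (r := c / r)).subset fun h hh => ?_
    rw [mem_closedBall_zero_iff, pi_norm_le_iff_of_nonneg (by positivity)]
    intro i
    have hmem : ∀ t : ℝ, |t| = r → t * h i ≤ c := fun t ht => by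
      have := hh (Pi.single i t) (hrW (by
        rw [mem_closedBall_zero_iff, Pi.norm_single, Real.norm_eq_abs, ht]))
      simpa using this
    have h1 := hmem r (abs_of_pos hr)
    have h2 := hmem (-r) (by rw [abs_neg, abs_of_pos hr])
    rw [Real.norm_eq_abs, le_div_iff₀ hr, ← abs_of_pos hr, ← abs_mul, abs_le]
    constructor <;> nlinarith

theorem convex_setOf_forall_dotProduct_le {m : ℕ} (W : Set (Fin m → ℝ)) (c : ℝ) :
    Convex ℝ {h : Fin m → ℝ | ∀ w ∈ W, w ⬝ᵥ h ≤ c} := by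
  simp only [Set.ofPred_forall]
  refine convex_iInter fun w => convex_iInter fun _ => convex_halfSpace_le ⟨?_, ?_⟩ c
  · exact fun x y => dotProduct_add w x y
  · exact fun a x => dotProduct_smul a w x

/-- A theorem of the alternative: `b` is represented as `vᵀ B + hᵀ A` with `v ∈ P` and `h` in the
`c`-multiple of the polar of `W` as soon as the dual inequality holds. -/
theorem exists_vecMul_add_vecMul_eq {ι : Type*} [Fintype ι] {m n : ℕ}
    (A : Matrix (Fin m) (Fin n) ℝ) (B : Matrix ι (Fin n) ℝ) {W : Set (Fin m → ℝ)}
    (hWc : IsClosed W) (hWconv : Convex ℝ W) (hW : W ∈ 𝓝 0) {P : Set (ι → ℝ)}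
    (hPc : IsCompact P) (hPconv : Convex ℝ P) (hPne : P.Nonempty) {c : ℝ} (hc : 0 < c)
    (b : Fin n → ℝ)
    (hdual : ∀ x : Fin n → ℝ, A *ᵥ x ∈ W → ∃ v ∈ P, b ⬝ᵥ x ≤ v ⬝ᵥ (B *ᵥ x) + c) :
    ∃ v ∈ P, ∃ h : Fin m → ℝ, (∀ w ∈ W, w ⬝ᵥ h ≤ c) ∧ v ᵥ* B + h ᵥ* A = b := by
  by_contra! hno
  set Q := {h : Fin m → ℝ | ∀ w ∈ W, w ⬝ᵥ h ≤ c} with hQ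
  let T : (ι → ℝ) × (Fin m → ℝ) →ₗ[ℝ] (Fin n → ℝ) :=
    (Matrix.vecMulLinear B).coprod (Matrix.vecMulLinear A)
  have hT : ∀ v h, T (v, h) = v ᵥ* B + h ᵥ* A := fun v h => by simp [T]
  have hC : IsCompact (T '' (P ×ˢ Q)) :=
    (hPc.prod (isCompact_setOf_forall_dotProduct_le hW hc)).image
      T.continuous_of_finiteDimensional
  have hCconv : Convex ℝ (T '' (P ×ˢ Q)) :=
    (hPconv.prod (convex_setOf_forall_dotProduct_le W c)).linear_image T
  have hb : b ∉ T '' (P ×ˢ Q) := by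
    rintro ⟨⟨v, h⟩, ⟨hv, hh⟩, heq⟩
    exact hno v hv h hh (by rw [← hT, heq])
  obtain ⟨f, s, hf, hs⟩ := geometric_hahn_banach_closed_point hCconv hC.isClosed hb
  obtain ⟨x, hx⟩ : ∃ x : Fin n → ℝ, ∀ y, f y = y ⬝ᵥ x := by
    refine ⟨fun i => f (Pi.single i 1), fun y => ?_⟩
    conv_lhs => rw [pi_eq_sum_univ' y, map_sum]
    simp [dotProduct]
  have hfle : ∀ v ∈ P, ∀ h ∈ Q, v ⬝ᵥ (B *ᵥ x) + h ⬝ᵥ (A *ᵥ x) < s := fun v hv h hh => by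
    have := hf _ ⟨(v, h), ⟨hv, hh⟩, rfl⟩
    rwa [hT, hx, add_dotProduct, ← dotProduct_mulVec, ← dotProduct_mulVec] at this
  obtain ⟨v₀, hv₀, hmax⟩ := hPc.exists_isMaxOn hPne (f := fun v => v ⬝ᵥ (B *ᵥ x)) (by
    unfold dotProduct
    fun_prop)
  have h0Q : (0 : Fin m → ℝ) ∈ Q := fun w _ => by simpa using hc.le
  have hd : 0 < s - v₀ ⬝ᵥ (B *ᵥ x) := by
    have := hfle v₀ hv₀ 0 h0Q
    rw [zero_dotProduct] at this
    linarith
  -- The gap `d` bounds `hᵀAx` over `Q`, so scaling `x` by `c / d` brings this bound to `c` and puts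
  -- `Ax` into the bipolar of `W`. The dual inequality then gives `bᵀx ≤ v₀ᵀBx + d = s`, against the
  -- separation.
  set d := s - v₀ ⬝ᵥ (B *ᵥ x) with hddef
  have hz : A *ᵥ ((c / d) • x) ∈ W := by
    refine mem_of_forall_dotProduct_le hWc hWconv (mem_of_mem_nhds hW) hc fun h hh => ?_
    have := hfle v₀ hv₀ h hh
    rw [mulVec_smul, smul_dotProduct, dotProduct_comm, smul_eq_mul, div_mul_eq_mul_div,
      div_le_iff₀ hd]
    exact mul_le_mul_of_nonneg_left (by linarith) hc.le
  obtain ⟨v, hv, hle⟩ := hdual _ hz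
  have hvm : v ⬝ᵥ (B *ᵥ x) ≤ v₀ ⬝ᵥ (B *ᵥ x) := hmax hv
  rw [hx] at hs
  rw [mulVec_smul, dotProduct_smul, dotProduct_smul, smul_eq_mul, smul_eq_mul] at hle
  have hcd : 0 < c / d := div_pos hc hd
  have hc' : c = c / d * d := by field_simp
  have h2 : c / d * (b ⬝ᵥ x) ≤ c / d * (v ⬝ᵥ (B *ᵥ x) + d) := by
    rw [mul_add, ← hc']
    exact hle
  have := le_of_mul_le_mul_left h2 hcd
  linarith

end Duality

/-! ### Block norms and their duals. -/

section Blocks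

variable {K : ℕ} {nb : Fin K → ℕ}

theorem norm_block_smul (c : ℝ) (w : BlockIdx nb → ℝ) (k : Fin K) :
    ‖block (c • w) k‖ = |c| * ‖block w k‖ := by
  have : block (c • w) k = c • block w k := rfl
  rw [this, norm_smul, Real.norm_eq_abs]

theorem L1_smul (c : ℝ) (w : BlockIdx nb → ℝ) : L1 (c • w) = |c| * L1 w := by
  simp only [L1, norm_block_smul, Finset.mul_sum]

/-- The only property of the truncation that is needed. Being sign-symmetric, the bound avoids
comparing how ties are resolved for `w` and `-w`. -/
theorem L1_sub_blockTrunc_le (s : ℕ) (w : BlockIdx nb → ℝ) :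
    L1 (w - blockTrunc s w) ≤ L1 w := by
  refine Finset.sum_le_sum fun k _ => ?_
  by_cases hk : k ∈ topBlocks s w
  · have : block (w - blockTrunc s w) k = 0 := by
      ext j
      simp [block, blockTrunc, hk]
    rw [this, norm_zero]
    exact norm_nonneg _
  · have : block (w - blockTrunc s w) k = block w k := by
      ext j
      simp [block, blockTrunc, hk]
    rw [this]

theorem L1_nonneg (w : BlockIdx nb → ℝ) : 0 ≤ L1 w := Finset.sum_nonneg fun _ _ => norm_nonneg _

theorem exists_sum_abs_le_one_dotProduct_eq_norm {p : ℕ} (w : Fin p → ℝ) :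
    ∃ v : Fin p → ℝ, ∑ j, |v j| ≤ 1 ∧ v ⬝ᵥ w = ‖w‖ := by
  rcases isEmpty_or_nonempty (Fin p) with hp | hp
  · refine ⟨0, by simp, ?_⟩
    rw [Subsingleton.elim w 0]
    simp
  · obtain ⟨j, -, hj⟩ := Finset.exists_max_image Finset.univ (fun j => |w j|)
      Finset.univ_nonempty
    refine ⟨Pi.single j (SignType.sign (w j)), ?_, ?_⟩
    · rw [Finset.sum_eq_single j (fun i _ hi => by simp [hi]) (by simp)]
      rcases lt_trichotomy (w j) 0 with h | h | h <;> simp [h]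
    · rw [single_dotProduct, sign_mul_self]
      refine le_antisymm (norm_le_pi_norm w j) ?_
      exact (pi_norm_le_iff_of_nonneg (abs_nonneg _)).2 fun i => hj i (Finset.mem_univ i)

/-- The polar of the unit ball of `L1`, scaled by `t`. -/
def blockBall (nb : Fin K → ℕ) (t : ℝ) : Set (BlockIdx nb → ℝ) :=
  {v | ∀ k, ∑ j, |v ⟨k, j⟩| ≤ t}

/-- Blockwise duality of `ℓ₁` and `ℓ_∞`, with extremal vectors chosen independently in the blocks.
-/
theorem exists_mem_blockBall_dotProduct_eq {t : ℝ} (ht : 0 ≤ t) (w : BlockIdx nb → ℝ) :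
    ∃ v ∈ blockBall nb t, v ⬝ᵥ w = t * L1 w := by
  choose v hv1 hv2 using fun k => exists_sum_abs_le_one_dotProduct_eq_norm (block w k)
  refine ⟨fun i => t * v i.1 i.2, fun k => ?_, ?_⟩
  · simp only [abs_mul, abs_of_nonneg ht, ← Finset.mul_sum]
    exact mul_le_of_le_one_right ht (hv1 k)
  · simp only [dotProduct, Fintype.sum_sigma, L1, ← hv2, block, Finset.mul_sum, mul_assoc]

theorem convex_blockBall (nb : Fin K → ℕ) (t : ℝ) : Convex ℝ (blockBall nb t) := by
  intro v hv w hw a b ha hb hab k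
  calc ∑ j, |(a • v + b • w) ⟨k, j⟩|
      ≤ ∑ j, (a * |v ⟨k, j⟩| + b * |w ⟨k, j⟩|) := by
        refine Finset.sum_le_sum fun j _ => (abs_add_le _ _).trans_eq ?_
        simp [abs_mul, abs_of_nonneg ha, abs_of_nonneg hb]
    _ = a * ∑ j, |v ⟨k, j⟩| + b * ∑ j, |w ⟨k, j⟩| := by
        rw [Finset.sum_add_distrib, Finset.mul_sum, Finset.mul_sum]
    _ ≤ a * t + b * t := add_le_add (mul_le_mul_of_nonneg_left (hv k) ha)
        (mul_le_mul_of_nonneg_left (hw k) hb)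
    _ = t := by rw [← add_mul, hab, one_mul]

theorem isCompact_blockBall (nb : Fin K → ℕ) {t : ℝ} (ht : 0 ≤ t) :
    IsCompact (blockBall nb t) := by
  refine Metric.isCompact_of_isClosed_isBounded ?_ ?_
  · simp only [blockBall, Set.ofPred_forall]
    exact isClosed_iInter fun k => isClosed_le (by fun_prop) continuous_const
  · refine (Metric.isBounded_closedBall (x := (0 : BlockIdx nb → ℝ)) (r := t)).subset
      fun v hv => ?_
    rw [mem_closedBall_zero_iff, pi_norm_le_iff_of_nonneg ht]
    exact fun ⟨k, j⟩ => (Finset.single_le_sum (f := fun j => |v ⟨k, j⟩|)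
      (fun _ _ => abs_nonneg _) (Finset.mem_univ j)).trans (hv k)

theorem normInfInf_le {p q : ℕ} (M : Matrix (Fin p) (Fin q) ℝ) {t : ℝ} (ht : 0 ≤ t)
    (hM : ∀ i, ∑ j, |M i j| ≤ t) : normInfInf M ≤ t := by
  refine ContinuousLinearMap.opNorm_le_bound _ ht fun v => ?_
  rw [pi_norm_le_iff_of_nonneg (by positivity)]
  intro i
  calc ‖∑ j, M i j * v j‖ ≤ ∑ j, |M i j| * ‖v‖ := by
        refine norm_sum_le_of_le _ fun j _ => ?_
        rw [norm_mul, Real.norm_eq_abs]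
        exact mul_le_mul_of_nonneg_left (norm_le_pi_norm v j) (abs_nonneg _)
    _ = (∑ j, |M i j|) * ‖v‖ := by rw [Finset.sum_mul]
    _ ≤ t * ‖v‖ := mul_le_mul_of_nonneg_right (hM i) (norm_nonneg _)

end Blocks

/-! ### The set of observation errors and its support function. -/

section ObservationError

variable {m : ℕ}

/-- The sum of `U` and the image under `D` of the Euclidean ball of radius `q`. -/
def errorSet (U : Set (Fin m → ℝ)) (D : Matrix (Fin m) (Fin m) ℝ) (q : ℝ) : Set (Fin m → ℝ) :=
  {y | ∃ u ∈ U, ∃ e : Fin m → ℝ, norm2 e ≤ q ∧ y = u + D *ᵥ e}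

theorem errorSet_eq_image (U : Set (Fin m → ℝ)) (D : Matrix (Fin m) (Fin m) ℝ) (q : ℝ) :
    errorSet U D q = (LinearMap.id.coprod
      (Matrix.mulVecLin D ∘ₗ (WithLp.linearEquiv 2 ℝ (Fin m → ℝ)).toLinearMap)) ''
        (U ×ˢ Metric.closedBall (0 : EuclideanSpace ℝ (Fin m)) q) := by
  ext y
  constructor
  · rintro ⟨u, hu, e, he, rfl⟩
    exact ⟨(u, WithLp.toLp 2 e), ⟨hu, mem_closedBall_zero_iff.2 he⟩, by simp⟩
  · rintro ⟨⟨u, e⟩, ⟨hu, he⟩, rfl⟩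
    exact ⟨u, hu, WithLp.ofLp e, mem_closedBall_zero_iff.1 he, by simp⟩

theorem isCompact_errorSet {U : Set (Fin m → ℝ)} (hU : IsCompact U)
    (D : Matrix (Fin m) (Fin m) ℝ) (q : ℝ) : IsCompact (errorSet U D q) := by
  rw [errorSet_eq_image]
  exact (hU.prod (isCompact_closedBall _ _)).image (LinearMap.continuous_of_finiteDimensional _)

theorem convex_errorSet {U : Set (Fin m → ℝ)} (hU : Convex ℝ U)
    (D : Matrix (Fin m) (Fin m) ℝ) (q : ℝ) : Convex ℝ (errorSet U D q) := by
  rw [errorSet_eq_image]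
  exact (hU.prod (convex_closedBall _ _)).linear_image _

theorem suppFun_add_mul_norm2_le {U : Set (Fin m → ℝ)} (hU : U.Nonempty)
    {D : Matrix (Fin m) (Fin m) ℝ} {q c : ℝ} (hq : 0 ≤ q) {h : Fin m → ℝ}
    (hh : ∀ w ∈ errorSet U D q, w ⬝ᵥ h ≤ c) :
    suppFun U h + q * norm2 (Dᵀ *ᵥ h) ≤ c := by
  set g := Dᵀ *ᵥ h with hg
  -- The case of equality in Cauchy–Schwarz: `e` is the multiple of `g` of length `q`.
  obtain ⟨e, he, heg⟩ : ∃ e : Fin m → ℝ, norm2 e ≤ q ∧ e ⬝ᵥ g = q * norm2 g := by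
    rcases (norm2_nonneg g).eq_or_lt with h0 | hpos
    · exact ⟨0, by simpa [norm2] using hq, by simp [← h0]⟩
    · refine ⟨(q / norm2 g) • g, ?_, ?_⟩
      · rw [norm2_smul, abs_of_nonneg (by positivity), div_mul_cancel₀ _ hpos.ne']
      · rw [smul_dotProduct, dotProduct_self_eq_norm2_sq, smul_eq_mul]
        field_simp
  rw [← le_sub_iff_add_le]
  refine csSup_le (hU.image _) ?_
  rintro _ ⟨u, hu, rfl⟩
  have := hh _ ⟨u, hu, e, he, rfl⟩
  rw [add_dotProduct, ← vecMul_transpose, ← dotProduct_mulVec, ← hg, heg] at this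
  simp only
  linarith

end ObservationError

/-! ### From successful recovery to an inequality on signals; two-sided Gaussian tails. -/

section Recovery

variable {m n K : ℕ} {nb : Fin K → ℕ}

theorem measurable_mulVec (D : Matrix (Fin m) (Fin m) ℝ) :
    Measurable fun η : Fin m → ℝ => D *ᵥ η :=
  (Matrix.mulVecLin D).continuous_of_finiteDimensional.measurable

/-- The testing bound needs measurable sets, while success events are only null measurable. An inner
approximation loses no probability and keeps disjointness. -/
theorem exists_measurable_subset_preimage_mulVec {D : Matrix (Fin m) (Fin m) ℝ}
    {E : Set (Fin m → ℝ)} (hE : NullMeasurableSet E (noiseLaw D)) :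
    ∃ T : Set (Fin m → ℝ), MeasurableSet T ∧ (∀ η ∈ T, D *ᵥ η ∈ E) ∧
      (Measure.pi fun _ : Fin m => gaussianReal 0 1).real T = (noiseLaw D).real E := by
  have hD := measurable_mulVec D
  obtain ⟨T, hTE, hT, hae⟩ := (hE.preimage (f := fun η => D *ᵥ η)
    (μa := Measure.pi fun _ : Fin m => gaussianReal 0 1)
    ⟨hD, Measure.AbsolutelyContinuous.rfl⟩).exists_measurable_subset_ae_eq
  refine ⟨T, hT, hTE, ?_⟩
  rw [measureReal_congr hae, measureReal_def, measureReal_def, noiseLaw,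
    Measure.map_apply₀ hD.aemeasurable hE]

/-- A signal indistinguishable from its opposite is small in the recovered representation. -/
theorem norm_mulVec_le_of_recovery {A : Matrix (Fin m) (Fin n) ℝ}
    {B : Matrix (BlockIdx nb) (Fin n) ℝ} {U : Set (Fin m → ℝ)} {D : Matrix (Fin m) (Fin m) ℝ}
    {ε : ℝ} (hε : ε < 1) {S : ℕ} {α : ℝ} {xhat : (Fin m → ℝ) → (Fin n → ℝ)}
    (hmeas : ∀ (x : Fin n → ℝ), ∀ u ∈ U, NullMeasurableSet
      {ξ | ‖B *ᵥ (x - xhat (A *ᵥ x + u + ξ))‖ ≤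
        α + (S : ℝ)⁻¹ * L1 (B *ᵥ x - blockTrunc S (B *ᵥ x))} (noiseLaw D))
    (hrec : ∀ (x : Fin n → ℝ), ∀ u ∈ U, 1 - ε ≤ (noiseLaw D).real
      {ξ | ‖B *ᵥ (x - xhat (A *ᵥ x + u + ξ))‖ ≤
        α + (S : ℝ)⁻¹ * L1 (B *ᵥ x - blockTrunc S (B *ᵥ x))})
    {x : Fin n → ℝ} {u e : Fin m → ℝ} (hu : u ∈ U) (hnu : -u ∈ U) (hx : A *ᵥ x = u + D *ᵥ e)
    (he : norm2 e < erfInv ε) :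
    ‖B *ᵥ x‖ ≤ α + (S : ℝ)⁻¹ * L1 (B *ᵥ x) := by
  by_contra! hlt
  obtain ⟨T₁, hT₁, hT₁E, hT₁p⟩ := exists_measurable_subset_preimage_mulVec (hmeas x _ hnu)
  obtain ⟨T₂, hT₂, hT₂E, hT₂p⟩ := exists_measurable_subset_preimage_mulVec (hmeas (-x) _ hu)
  -- After the shifts both signals yield the same observation `Dη`, hence the same estimate. If it
  -- were good for both `x` and `-x`, the triangle inequality would bound `2‖Bx‖`, against `hlt`.
  have hdisj : Disjoint ((fun η => η - e) ⁻¹' T₁) ((fun η => η + e) ⁻¹' T₂) := by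
    refine Set.disjoint_left.2 fun η h₁ h₂ => ?_
    have h₁' := hT₁E _ h₁
    have h₂' := hT₂E _ h₂
    have e₁ : A *ᵥ x + -u + D *ᵥ (η - e) = D *ᵥ η := by
      rw [hx, mulVec_sub]
      abel
    have e₂ : A *ᵥ (-x) + u + D *ᵥ (η + e) = D *ᵥ η := by
      rw [mulVec_neg, hx, mulVec_add]
      abel
    simp only [Set.mem_ofPred_eq, e₁, e₂] at h₁' h₂'
    have b₁ := L1_sub_blockTrunc_le S (B *ᵥ x)
    have b₂ := L1_sub_blockTrunc_le S (B *ᵥ (-x))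
    have hneg : L1 (B *ᵥ (-x)) = L1 (B *ᵥ x) := by
      rw [mulVec_neg, ← neg_one_smul ℝ, L1_smul]
      simp
    rw [hneg] at b₂
    have hS : (0 : ℝ) ≤ (S : ℝ)⁻¹ := by positivity
    have c₁ := mul_le_mul_of_nonneg_left b₁ hS
    have c₂ := mul_le_mul_of_nonneg_left b₂ hS
    have h2 : (2 : ℝ) • (B *ᵥ x) =
        B *ᵥ (x - xhat (D *ᵥ η)) - B *ᵥ (-x - xhat (D *ᵥ η)) := by
      rw [← mulVec_sub, two_smul, ← mulVec_add]
      congr 1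
      abel
    have h3 := norm_sub_le (B *ᵥ (x - xhat (D *ᵥ η))) (B *ᵥ (-x - xhat (D *ᵥ η)))
    rw [← h2, norm_smul, Real.norm_eq_abs, abs_two] at h3
    linarith
  have key := pi_gaussianReal_real_add_le_of_disjoint e (hT₁.preimage (by fun_prop))
    (hT₂.preimage (by fun_prop)) hdisj
  simp only [Set.preimage_preimage, add_sub_cancel_right, sub_add_cancel, Set.preimage_id'] at key
  have h₁ := hrec x _ hnu
  have h₂ := hrec (-x) _ hu
  have ht := lt_gaussianTail_of_lt_erfInv hε he
  linarith

theorem pi_gaussianReal_real_setOf_lt_abs_dotProduct_le {δ : ℝ} (hδ : 0 < δ)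
    (g : Fin m → ℝ) :
    (Measure.pi fun _ : Fin m => gaussianReal 0 1).real
      {η | erfInv δ * norm2 g < |η ⬝ᵥ g|} ≤ 2 * δ := by
  have hd : Measurable fun η : Fin m → ℝ => η ⬝ᵥ g := by unfold dotProduct; fun_prop
  have hms : MeasurableSet {s : ℝ | erfInv δ * norm2 g < |s|} :=
    measurableSet_lt measurable_const (by fun_prop)
  have h : {η : Fin m → ℝ | erfInv δ * norm2 g < |η ⬝ᵥ g|} =
      (fun η => η ⬝ᵥ g) ⁻¹' {s : ℝ | erfInv δ * norm2 g < |s|} := rfl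
  rw [h, ← map_measureReal_apply hd hms, map_dotProduct_pi_gaussianReal,
    map_measureReal_apply (by fun_prop) hms]
  have hsub : (fun t => norm2 g * t) ⁻¹' {s : ℝ | erfInv δ * norm2 g < |s|} ⊆
      Set.Ioi (erfInv δ) ∪ Set.Iio (-erfInv δ) := by
    intro t ht
    simp only [Set.mem_preimage, Set.mem_ofPred_eq, abs_mul, abs_of_nonneg (norm2_nonneg g),
      mul_comm (erfInv δ)] at ht
    have := lt_of_mul_lt_mul_left ht (norm2_nonneg g)
    rcases lt_abs.1 this with h | h
    · exact Or.inl h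
    · exact Or.inr (lt_neg_of_lt_neg h)
  have hneg : (gaussianReal 0 1).real (Set.Iio (-erfInv δ)) =
      (gaussianReal 0 1).real (Set.Ioi (erfInv δ)) := by
    have h := gaussianReal_map_neg (μ := 0) (v := 1)
    rw [neg_zero] at h
    rw [← h, map_measureReal_apply measurable_neg measurableSet_Iio, h]
    congr 1
    ext x
    simp
  have := gaussianReal_real_Ioi_erfInv_le hδ
  calc _ ≤ _ := measureReal_mono hsub
    _ ≤ _ := measureReal_union_le _ _
    _ ≤ 2 * δ := by rw [hneg]; linarith

end Recovery

/-! ### Noise level of the contrast matrix. -/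

section Rho

variable {m K : ℕ} {nb : Fin K → ℕ}

theorem le_rho (U : Set (Fin m → ℝ)) (D : Matrix (Fin m) (Fin m) ℝ) (ε : ℝ)
    (H : Matrix (Fin m) (BlockIdx nb) ℝ) (i : BlockIdx nb) :
    suppFun U (H.col i) + erfInv (ε / (2 * (∑ k, nb k : ℕ))) * norm2 (Dᵀ *ᵥ H.col i) ≤
      rho U D ε H :=
  le_ciSup (f := fun i => suppFun U (H.col i) +
    erfInv (ε / (2 * (∑ k, nb k : ℕ))) * norm2 (Dᵀ *ᵥ H.col i)) (Set.finite_range _).bddAbove i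

/-- A union bound: `N` columns with two tails each, every tail of mass at most `ε/(2N)`. -/
theorem one_sub_le_noiseLaw_real_setOf_le_rho (U : Set (Fin m → ℝ))
    (D : Matrix (Fin m) (Fin m) ℝ) {ε : ℝ} (hε0 : 0 < ε) (hN : 0 < ∑ k, nb k)
    (H : Matrix (Fin m) (BlockIdx nb) ℝ) :
    1 - ε ≤ (noiseLaw D).real
      {ξ | ∀ i : BlockIdx nb, suppFun U (H.col i) + |ξ ⬝ᵥ H.col i| ≤ rho U D ε H} := by
  have hD := measurable_mulVec D
  have hN' : (0 : ℝ) < (∑ k, nb k : ℕ) := by exact_mod_cast hN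
  set q := erfInv (ε / (2 * (∑ k, nb k : ℕ))) with hqdef
  set γ := Measure.pi fun _ : Fin m => gaussianReal 0 1 with hγ
  have hms : MeasurableSet
      {ξ : Fin m → ℝ | ∀ i, suppFun U (H.col i) + |ξ ⬝ᵥ H.col i| ≤ rho U D ε H} := by
    simp only [Set.ofPred_forall]
    refine MeasurableSet.iInter fun i => measurableSet_le ?_ measurable_const
    unfold dotProduct
    fun_prop
  rw [noiseLaw, map_measureReal_apply hD hms]
  set E := (fun η => D *ᵥ η) ⁻¹'
    {ξ : Fin m → ℝ | ∀ i, suppFun U (H.col i) + |ξ ⬝ᵥ H.col i| ≤ rho U D ε H} with hE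
  have hsub : Eᶜ ⊆ ⋃ i : BlockIdx nb,
      {η : Fin m → ℝ | q * norm2 (Dᵀ *ᵥ H.col i) < |η ⬝ᵥ (Dᵀ *ᵥ H.col i)|} := by
    intro η hη
    by_contra hcon
    refine hη fun i => le_trans ?_ (le_rho U D ε H i)
    simp only [Set.mem_iUnion, Set.mem_ofPred_eq, not_exists, not_lt] at hcon
    have := hcon i
    rw [dotProduct_mulVec, vecMul_transpose] at this
    linarith
  have hcard : (Fintype.card (BlockIdx nb) : ℝ) = (∑ k, nb k : ℕ) := by simp
  have hle : γ.real Eᶜ ≤ ε := by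
    calc γ.real Eᶜ ≤ _ := measureReal_mono hsub
      _ ≤ ∑ i : BlockIdx nb,
          γ.real {η | q * norm2 (Dᵀ *ᵥ H.col i) < |η ⬝ᵥ (Dᵀ *ᵥ H.col i)|} :=
        measureReal_iUnion_fintype_le _
      _ ≤ ∑ _i : BlockIdx nb, 2 * (ε / (2 * (∑ k, nb k : ℕ))) :=
        Finset.sum_le_sum fun i _ =>
          pi_gaussianReal_real_setOf_lt_abs_dotProduct_le (by positivity) _
      _ = ε := by
        rw [Finset.sum_const, Finset.card_univ, nsmul_eq_mul, hcard]
        field_simp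
  rw [probReal_compl_eq_one_sub (hms.preimage hD)] at hle
  linarith

end Rho

end BlockRecovery

/-! ### Assembly of `H` and `V` row by row. -/

theorem proposition3 {m n K : ℕ} (nb : Fin K → ℕ) (hN : 0 < ∑ k, nb k)
    (A : Matrix (Fin m) (Fin n) ℝ) (B : Matrix (BlockIdx nb) (Fin n) ℝ)
    (U : Set (Fin m → ℝ)) (hUcompact : IsCompact U) (hUconvex : Convex ℝ U)
    (hUsymm : ∀ u ∈ U, -u ∈ U)
    (D : Matrix (Fin m) (Fin m) ℝ)
    (ε : ℝ) (hε0 : 0 < ε) (hε1 : ε < 1 / 2)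
    -- the observation error is present
    (hobs : ∀ r : ℝ, 0 < r →
      {y : Fin m → ℝ | ∃ u ∈ U, ∃ e : Fin m → ℝ, norm2 e ≤ r ∧ y = u + D *ᵥ e} ∈ 𝓝 0)
    (S : ℕ) (hS : 0 < S) (α : ℝ) (hα : 0 < α)
    (xhat : (Fin m → ℝ) → (Fin n → ℝ))
    -- the success event is measurable (up to a null set); automatic for a Borel `xhat`
    (hmeas : ∀ (x : Fin n → ℝ), ∀ u ∈ U, NullMeasurableSet
      {ξ | ‖B *ᵥ (x - xhat (A *ᵥ x + u + ξ))‖ ≤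
        α + (S : ℝ)⁻¹ * L1 (B *ᵥ x - blockTrunc S (B *ᵥ x))} (noiseLaw D))
    (hrec : ∀ (x : Fin n → ℝ), ∀ u ∈ U, 1 - ε ≤ (noiseLaw D).real
      {ξ | ‖B *ᵥ (x - xhat (A *ᵥ x + u + ξ))‖ ≤
        α + (S : ℝ)⁻¹ * L1 (B *ᵥ x - blockTrunc S (B *ᵥ x))}) :
    ∃ (H : Matrix (Fin m) (BlockIdx nb) ℝ) (V : Matrix (BlockIdx nb) (BlockIdx nb) ℝ),
      B = V * B + Hᵀ * A ∧
      (∀ k l : Fin K, normInfInf (matBlock V k l) ≤ 2 * (S : ℝ)⁻¹) ∧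
      (D = 0 → rho U D ε H ≤ 2 * α) ∧
      (D ≠ 0 → rho U D ε H ≤
        2 * α * (erfInv (ε / (2 * (∑ k, nb k : ℕ))) / erfInv ε)) ∧
      1 - ε ≤ (noiseLaw D).real
        {ξ | ∀ i : BlockIdx nb, suppFun U (H.col i) + |ξ ⬝ᵥ H.col i| ≤ rho U D ε H} := by
  have hN1 : (1 : ℝ) ≤ (∑ k, nb k : ℕ) := by exact_mod_cast hN
  have hq : 0 < erfInv ε := erfInv_pos hε0 hε1
  have hqq : erfInv ε ≤ erfInv (ε / (2 * (∑ k, nb k : ℕ))) :=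
    erfInv_le_erfInv (by positivity) (div_le_self hε0.le (by linarith)) (by linarith)
  have ht : (0 : ℝ) ≤ 2 * (S : ℝ)⁻¹ := by positivity
  have hW : errorSet U D (erfInv ε) ∈ 𝓝 0 := hobs _ hq
  obtain ⟨u₀, hu₀, -⟩ := mem_of_mem_nhds hW
  have hU0 : (0 : Fin m → ℝ) ∈ U := by
    have := hUconvex hu₀ (hUsymm _ hu₀) (a := 1 / 2) (b := 1 / 2) (by norm_num) (by norm_num)
      (by norm_num)
    simpa using this
  have hrow : ∀ i : BlockIdx nb, ∃ v ∈ blockBall nb (2 * (S : ℝ)⁻¹), ∃ h : Fin m → ℝ,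
      (∀ w ∈ errorSet U D (erfInv ε), w ⬝ᵥ h ≤ 2 * α) ∧ v ᵥ* B + h ᵥ* A = B.row i := by
    intro i
    refine exists_vecMul_add_vecMul_eq A B (isCompact_errorSet hUcompact D _).isClosed
      (convex_errorSet hUconvex D _) hW (isCompact_blockBall nb ht) (convex_blockBall nb _)
      ⟨0, fun k => by simp⟩ (by positivity) _ fun x hx => ?_
    obtain ⟨v, hv, hvx⟩ := exists_mem_blockBall_dotProduct_eq ht (B *ᵥ x)
    refine ⟨v, hv, ?_⟩
    obtain ⟨u, hu, e, he, hxe⟩ := hx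
    -- The recovery bound is applied to `x/2`: halving makes `‖e‖₂ ≤ ErfInv(ε)` strict and turns `α`
    -- into `2α`. The coefficient of `L₁(Bx)` stays `S⁻¹`, within the allowed `2S⁻¹`.
    have hu2 : (1 / 2 : ℝ) • u ∈ U :=
      hUconvex.smul_mem_of_zero_mem hU0 hu ⟨by norm_num, by norm_num⟩
    have hle := norm_mulVec_le_of_recovery (by linarith) hmeas hrec (x := (1 / 2 : ℝ) • x)
      (e := (1 / 2 : ℝ) • e) hu2 (hUsymm _ hu2) (by rw [mulVec_smul, hxe, smul_add, mulVec_smul])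
      (by rw [norm2_smul, abs_of_pos (by norm_num)]; linarith)
    rw [mulVec_smul, norm_smul, L1_smul, Real.norm_eq_abs, abs_of_pos (by norm_num)] at hle
    have hbi : B.row i ⬝ᵥ x ≤ ‖B *ᵥ x‖ :=
      (le_abs_self _).trans (norm_le_pi_norm (B *ᵥ x) i)
    have hnn : 0 ≤ (S : ℝ)⁻¹ * L1 (B *ᵥ x) := mul_nonneg (by positivity) (L1_nonneg _)
    rw [hvx]
    linarith
  choose v hv h hh heq using hrow
  have hsupp : ∀ i, suppFun U (h i) + erfInv ε * norm2 (Dᵀ *ᵥ h i) ≤ 2 * α := fun i =>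
    suppFun_add_mul_norm2_le ⟨0, hU0⟩ hq.le (hh i)
  have hsupp0 : ∀ i, 0 ≤ suppFun U (h i) := fun i => by
    refine le_csSup ?_ ⟨0, hU0, zero_dotProduct _⟩
    refine (hUcompact.image ?_).bddAbove
    unfold dotProduct
    fun_prop
  have hne : Nonempty (BlockIdx nb) := by
    rw [← Fintype.card_pos_iff]
    simpa using hN
  refine ⟨(Matrix.of h)ᵀ, Matrix.of v, ?_, fun k l => ?_, fun hD => ?_, fun _ => ?_, ?_⟩
  · ext i j
    exact (congrFun (heq i) j).symm
  · exact normInfInf_le _ ht fun i => hv ⟨k, i⟩ l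
  · refine ciSup_le fun i => ?_
    have := hsupp i
    change suppFun U (h i) + _ * norm2 (Dᵀ *ᵥ h i) ≤ 2 * α
    have h0 : norm2 (Dᵀ *ᵥ h i) = 0 := by simp [hD, norm2]
    rw [h0] at this ⊢
    linarith
  · refine ciSup_le fun i => ?_
    change suppFun U (h i) + _ * norm2 (Dᵀ *ᵥ h i) ≤ _
    -- With `q = ErfInv(ε) ≤ q' = ErfInv(ε/(2N))` and a support function `μ ≥ 0`, one has `(μ +
    -- q'‖Dᵀh‖₂) q ≤ q' (μ + q‖Dᵀh‖₂) ≤ 2α q'`.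
    rw [← mul_div_assoc, le_div_iff₀ hq]
    have h1 := mul_le_mul_of_nonneg_right (hsupp i) (hq.le.trans hqq)
    have h2 := mul_le_mul_of_nonneg_left hqq (hsupp0 i)
    linarith
  · exact one_sub_le_noiseLaw_real_setOf_le_rho U D hε0 hN _
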